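/- All spaces below are topological spaces, with no separation axioms assumed unless stated. For infinite cardinals $\lambda,\mu$, a space is *$[\lambda,\mu]$-compact* if every open cover by at most $\mu$ sets has a subcover by fewer than $\lambda$ sets. A family of spaces is *productively $[\lambda,\mu]$-compact* if every Tychonoff product of members of the family (repetitions allowed) is $[\lambda,\mu]$-compact; a space $X$ is *productively $[\lambda,\mu]$-compact* if every Tychonoff power of $X$ is $[\lambda,\mu]$-compact. An ultrafilter $D$ over a set $I$ is *$(\lambda,\mu)$-regular* if there is a function $f$ from $I$ to the set of subsets of $\mu$ of cardinality $<\lambda$ such that $\{i\in I : \alpha\in f(i)\}\in D$ for every $\alpha\in\mu$. **Theorem.** For all infinite cardinals $\lambda,\mu,\kappa$ (with $\kappa$ possibly singular), the following conditions are equivalent. (i) Every productively $[\lambda,\mu]$-compact topological space is $[\kappa,\kappa]$-compact. (i)$_{\mathrm p}$ Every productively $[\lambda,\mu]$-compact topological space is productively $[\kappa,\kappa]$-compact. (ii) Every productively $[\lambda,\mu]$-compact family of topological spaces is productively $[\kappa,\kappa]$-compact. (iii) Every $(\lambda,\mu)$-regular ultrafilter is $(\kappa,\kappa)$-regular. (iv)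 Every productively $[\lambda,\mu]$-compact Hausdorff normal topological space with a base of clopen sets is productively $[\kappa,\kappa]$-compact. (v) Every productively $[\lambda,\mu]$-compact Tychonoff topological group with a base of clopen sets is $[\kappa,\kappa]$-compact. (v)$_{\mathrm p}$ Every productively $[\lambda,\mu]$-compact Tychonoff topological group with a base of clopen sets is productively $[\kappa,\kappa]$-compact. If $\kappa$ is regular, then the preceding conditions are also equivalent to: (vi) Every productively $[\lambda,\mu]$-compact Hausdorff normal topological space with a base of clopen sets is $[\kappa,\kappa]$-compact. -/

import Mathlib

universe u

open Cardinal TopologicalSpace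

/-- A topological space `X` is `[lam, μ]`-compact if every open cover of `X` by at most `μ` sets
has a subcover by fewer than `lam` sets. -/
def IntervalCompact (lam μ : Cardinal.{u}) (X : Type u) [TopologicalSpace X] : Prop :=
  ∀ 𝒰 : Set (Set X), (∀ U ∈ 𝒰, IsOpen U) → ⋃₀ 𝒰 = Set.univ → #𝒰 ≤ μ →
    ∃ 𝒱 ⊆ 𝒰, #𝒱 < lam ∧ ⋃₀ 𝒱 = Set.univ

/-- A family of topological spaces is productively `[lam, μ]`-compact if every Tychonoff product
of members of the family, repetitions allowed, is `[lam, μ]`-compact. -/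
def FamilyProductivelyCompact (lam μ : Cardinal.{u}) {ι : Type u} (X : ι → Type u)
    [∀ i, TopologicalSpace (X i)] : Prop :=
  ∀ (J : Type u) (g : J → ι), IntervalCompact lam μ (∀ j, X (g j))

/-- A topological space is productively `[lam, μ]`-compact if all its Tychonoff powers are
`[lam, μ]`-compact. -/
def ProductivelyCompact (lam μ : Cardinal.{u}) (X : Type u) [TopologicalSpace X] : Prop :=
  ∀ J : Type u, IntervalCompact lam μ (J → X)

/-- An ultrafilter `D` over `I` is `(lam, μ)`-regular if there is a function `f` from `I` to the
subsets of (a set of cardinality) `μ` having cardinality `< lam` such that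
`{i | α ∈ f i} ∈ D` for every `α ∈ μ`. Equivalently, there are `μ` members of `D`, indexed by `μ`,
such that the intersection of any `lam` of them (distinct indices) is empty. -/
def RegularUltrafilter (lam μ : Cardinal.{u}) {I : Type u} (D : Ultrafilter I) : Prop :=
  ∃ f : I → Set μ.out, (∀ i, #(f i) < lam) ∧ ∀ α : μ.out, {i | α ∈ f i} ∈ D

/-- The clopen sets form a base of the topology. -/
def HasClopenBase (X : Type u) [TopologicalSpace X] : Prop :=
  IsTopologicalBasis {s : Set X | IsClopen s}

/-! A family is productively [λ,μ]-compact exactly when it is `D`-compact for a single (λ,μ)-regular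
ultrafilter `D`: `D`-compactness passes to products and implies [λ,μ]-compactness, and if every
candidate `D` failed, one product would collect all the failures
(`FamilyProductivelyCompact.exists_ultrafilterCompact`). So the transfer of regularity yields every
transfer of compactness. Conversely, let `D` be (λ,μ)-regular but not (κ,κ)-regular. The group of
functions with support smaller than κ is `D`-compact but not [κ,κ]-compact, whether or not κ is
regular. Among normal spaces, a regular κ with its order topology does the same. For singular κ, the
disjoint sum of the ordinals cf κ and κ⁺ works, because (κ,κ)-regularity means regularity at cf κ or
at κ⁺ (`regularUltrafilter_iff_of_isSingular`). The hard half of that equivalence, from κ up to κ⁺,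
rests on κ⁺ functions from cf κ to κ such that a set of bounded size below κ meets only a bounded
set of them cofinally often (`exists_not_isCofinal_setOf_frequently_mem`). They are ranks of sparse
well-founded relations, and club guessing shows that they spread out. -/

/-! ### Clubs, normal sequences and club guessing -/

section WellOrders

open Order Set

variable {α : Type u} [LinearOrder α]

/-- In a well-order every bounded nonempty set has a least upper bound. -/
theorem exists_isLUB_of_bddAbove [WellFoundedLT α] {s : Set α} (hs : BddAbove s) :
    ∃ x, IsLUB s x :=
  ⟨_, WellFounded.min_mem wellFounded_lt (upperBounds s) hs,
    fun _ hy => WellFounded.min_le wellFounded_lt hy⟩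

/-- Every well-order without maximum has a club of cardinality its cofinality. -/
theorem exists_isClub_mk_le_cof (α : Type u) [LinearOrder α] [WellFoundedLT α] [NoMaxOrder α] :
    ∃ E : Set α, IsClub E ∧ #E ≤ Order.cof α := by
  obtain ⟨B, hB, hBc⟩ := Order.exists_cof_eq α
  refine ⟨{x | ∃ b ∈ B, IsLUB (B ∩ Iio b) x}, ⟨?_, ?_⟩, ?_⟩
  · intro s hs _ _ p hp
    obtain ⟨c, hc⟩ := exists_gt p
    obtain ⟨c', hc', hcc'⟩ := hB c
    -- The least element of `B` above the limit point `p` witnesses membership: nothing of `B` lies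
    -- strictly between them.
    have hne : (B ∩ Ioi p).Nonempty := ⟨c', hc', hc.trans_le hcc'⟩
    obtain ⟨hbB, hpb⟩ := WellFounded.min_mem wellFounded_lt _ hne
    refine ⟨_, hbB, ?_, ?_⟩
    · rintro x ⟨hxB, hxb⟩
      by_contra hx
      exact (WellFounded.not_lt_min wellFounded_lt (s := B ∩ Ioi p) ⟨hxB, not_le.1 hx⟩) hxb
    · intro v hv
      refine hp.2 fun q hq => ?_
      obtain ⟨b, -, hqb⟩ := hs hq
      refine hqb.2 fun x hx => hv ⟨hx.1, ?_⟩
      exact ((hqb.1 hx).trans (hp.1 hq)).trans_lt hpb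
  · intro x
    obtain ⟨b, hb, hxb⟩ := hB x
    obtain ⟨c, hc⟩ := exists_gt b
    obtain ⟨b', hb', hcb'⟩ := hB c
    obtain ⟨y, hy⟩ := exists_isLUB_of_bddAbove (s := B ∩ Iio b') ⟨b', fun x hx => hx.2.le⟩
    exact ⟨y, ⟨b', hb', hy⟩, hxb.trans (hy.1 ⟨hb, hc.trans_le hcb'⟩)⟩
  · rw [← hBc]
    choose f hfB hf using fun x : {x | ∃ b ∈ B, IsLUB (B ∩ Iio b) x} => x.2
    refine mk_le_of_injective (f := fun x => (⟨f x, hfB x⟩ : B)) fun x y hxy => ?_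
    have h : f x = f y := congrArg Subtype.val hxy
    exact Subtype.ext ((hf x).unique (h ▸ hf y))

/-- A normal sequence in a well-order which dominates, at every step, a prescribed function of its
own initial segments. -/
theorem exists_isNormal_forall_lt {T K : Type u} [LinearOrder T] [WellFoundedLT T]
    [LinearOrder K] [WellFoundedLT K] [NoMaxOrder K] [Nonempty K] (hTK : #T < Order.cof K)
    (F : ∀ a : T, (Iic a → K) → K) :
    ∃ ξ : T → K, IsNormal ξ ∧ ∀ b a, b < a → F b (fun c => ξ c) < ξ a := by
  let := WellFoundedLT.toOrderBot K
  let := WellFoundedLT.conditionallyCompleteLinearOrderBot K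
  choose G hG using fun x : K => exists_gt x
  let Φ : ∀ a : T, (∀ b, b < a → K) → K := fun a ih =>
    sSup (range fun b : Iio a =>
      G (max (F b.1 fun c => ih c.1 (lt_of_le_of_lt c.2 b.2)) (ih b.1 b.2)))
  let ξ : T → K := IsWellFounded.fix (· < ·) Φ
  have hξ (a : T) : ξ a = sSup (range fun b : Iio a => G (max (F b.1 fun c => ξ c) (ξ b.1))) :=
    IsWellFounded.fix_eq (· < ·) Φ a
  have hlt (b a : T) (h : b < a) : max (F b fun c => ξ c) (ξ b) < ξ a := by
    refine (hG _).trans_le ?_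
    rw [hξ a]
    refine le_csSup (.of_not_isCofinal fun hg => (cof_le hg).not_gt ?_) ⟨⟨b, h⟩, rfl⟩
    exact (mk_range_le.trans (mk_set_le _)).trans_lt hTK
  refine ⟨ξ, ⟨fun b a h => (le_max_right _ _).trans_lt (hlt b a h), ?_⟩,
    fun b a h => (le_max_left _ _).trans_lt (hlt b a h)⟩
  intro a ha v hv
  rw [hξ a]
  refine csSup_le' ?_
  rintro _ ⟨⟨b, hb⟩, rfl⟩
  obtain ⟨c, hbc, hca⟩ := ha.lt_iff_exists_lt.1 hb
  refine le_trans ?_ (hv ⟨c, hbc, rfl⟩)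
  rw [hξ c]
  refine le_csSup (.of_not_isCofinal fun hg => (cof_le hg).not_gt ?_) ⟨⟨b, hca⟩, rfl⟩
  exact (mk_range_le.trans (mk_set_le _)).trans_lt hTK

theorem isSuccLimit_of_aleph0_le_cof_Iio {a : α} (h : ℵ₀ ≤ Order.cof (Iio a)) : IsSuccLimit a := by
  refine ⟨fun hmin => ?_, fun b hb => ?_⟩
  · have : IsEmpty (Iio a) := ⟨fun x => hmin.not_lt x.2⟩
    simp [aleph0_ne_zero] at h
  · have h1 : Order.cof (Iio a) = 1 :=
      Order.cof_eq_one_iff.2 ⟨⟨b, hb.lt⟩, fun x => hb.le_of_lt x.2⟩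
    exact absurd (h1 ▸ h) one_lt_aleph0.not_ge

theorem cof_Iio_map_of_isNormal {T K : Type u} [LinearOrder T] [LinearOrder K] {f : T → K}
    (hf : IsNormal f) {a : T} (ha : IsSuccLimit a) : Order.cof (Iio (f a)) = Order.cof (Iio a) := by
  symm
  refine Order.cof_congr_of_strictMono (hf.to_Iio a).strictMono ?_
  rintro ⟨x, hx⟩
  obtain ⟨b, hb, hxb⟩ := (hf.lt_iff_exists_lt ha).1 hx
  exact ⟨_, ⟨⟨b, hb⟩, rfl⟩, hxb.le⟩

/-- In a regular cardinal, every club has limit points of any given smaller cofinality. -/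
theorem exists_cof_Iio_eq_of_isClub {T : Type u} [LinearOrder T] [WellFoundedLT T]
    [IsRegularCardinalOrder T] {σ : Cardinal.{u}} (hσ : σ.IsRegular) (hσT : σ < #T)
    {E : Set T} (hE : IsClub E) :
    ∃ γ : T, Order.cof (Iio γ) = σ ∧ ∀ x < γ, ∃ e ∈ E, x ≤ e ∧ e < γ := by
  have hlt : σ.ord < Ordinal.type (α := T) (· < ·) := by
    refine (ord_lt_ord.2 hσT).trans_le ?_
    rw [ord_le, Ordinal.card_type]
  -- `a` sits at position σ, so its image under the normal enumeration of `E` is a limit of `E` of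
  -- cofinality σ.
  let a : T := Ordinal.enum (· < ·) ⟨σ.ord, hlt⟩
  have ha : Order.cof (Iio a) = σ := by
    rw [Order.cof_Iio, Ordinal.typein_enum, hσ.cof_ord]
  have hal : IsSuccLimit a := isSuccLimit_of_aleph0_le_cof_Iio (ha ▸ hσ.aleph0_le)
  have hf := hE.isNormal_enum
  refine ⟨(Subtype.val ∘ Order.enum E hE.isCofinal) a, ?_, fun x hx => ?_⟩
  · rw [cof_Iio_map_of_isNormal hf hal, ha]
  · obtain ⟨b, hb, hxb⟩ := (hf.lt_iff_exists_lt hal).1 hx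
    exact ⟨_, (Order.enum E hE.isCofinal b).2, hxb.le, hf.strictMono hb⟩

theorem IsClub.exists_isGreatest [WellFoundedLT α] {E : Set α} (hE : IsClub E) {b : α}
    (h : (E ∩ Iic b).Nonempty) : ∃ x, IsGreatest (E ∩ Iic b) x := by
  obtain ⟨x, hx⟩ := exists_isLUB_of_bddAbove (s := E ∩ Iic b) ⟨b, fun x hx => hx.2⟩
  exact ⟨x, ⟨hE.isLUB_mem inter_subset_left h hx, hx.2 fun y hy => hy.2⟩, hx.1⟩

/-- A weak form of Shelah's club guessing. -/
theorem exists_club_guessing {T : Type u} [LinearOrder T] [WellFoundedLT T]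
    [IsRegularCardinalOrder T] {σ : Cardinal.{u}} (hσ : σ.IsRegular) (hσT : succ σ < #T) :
    ∃ C : T → Set T, ∀ E : Set T, IsClub E →
      ∃ γ, C γ ⊆ E ∧ σ ≤ #(C γ) ∧ ∀ a ∈ C γ, ∃ b ∈ C γ, a < b := by
  have hcofT : Order.cof T = #T := Order.cof_eq_cardinalMk
  have hcof0 : Order.cof T ≠ ℵ₀ := by
    rw [hcofT]
    exact ((hσ.aleph0_le.trans (le_succ σ)).trans_lt hσT).ne'
  choose B hB hBc using fun γ : T => Order.exists_cof_eq (Iio γ)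
  -- Each ladder `B γ` is pushed down into `E`. If every `E` failed to guess, the counterexamples
  -- could be intersected σ⁺ times.
  let C : Set T → T → Set T := fun E γ => {x | ∃ b ∈ B γ, IsGreatest (E ∩ Iic b.1) x}
  let S : Set T → Set T := fun E =>
    {γ | Order.cof (Iio γ) = σ ∧ ∀ x < γ, ∃ e ∈ E, x ≤ e ∧ e < γ}
  have hC (E : Set T) (hE : IsClub E) (γ : T) (hγ : γ ∈ S E) :
      σ ≤ #(C E γ) ∧ ∀ a ∈ C E γ, ∃ b ∈ C E γ, a < b := by
    have hlt : ∀ x ∈ C E γ, x < γ := by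
      rintro x ⟨b, -, hb⟩
      exact lt_of_le_of_lt hb.1.2 b.2
    have hcofinal : ∀ x < γ, ∃ y ∈ C E γ, x ≤ y := by
      intro x hx
      obtain ⟨e, heE, hxe, he⟩ := hγ.2 x hx
      obtain ⟨b, hb, heb⟩ := hB γ ⟨e, he⟩
      obtain ⟨y, hy⟩ := hE.exists_isGreatest (b := b.1) ⟨e, heE, heb⟩
      exact ⟨y, ⟨b, hb, hy⟩, hxe.trans (hy.2 ⟨heE, heb⟩)⟩
    constructor
    · rw [← hγ.1]
      have h1 : IsCofinal {y : Iio γ | y.1 ∈ C E γ} := by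
        rintro ⟨x, hx⟩
        obtain ⟨y, hy, hxy⟩ := hcofinal x hx
        exact ⟨⟨y, hlt y hy⟩, hy, hxy⟩
      refine (Order.cof_le h1).trans ?_
      exact mk_le_of_injective (f := fun y => (⟨y.1.1, y.2⟩ : C E γ))
        fun x y h => Subtype.ext (Subtype.ext (Subtype.mk.inj h))
    · intro a ha
      have hl : IsSuccLimit γ := isSuccLimit_of_aleph0_le_cof_Iio (hγ.1 ▸ hσ.aleph0_le)
      obtain ⟨c, hc, hac⟩ := hl.lt_iff_exists_lt.1 (hlt a ha)
      obtain ⟨y, hy, hcy⟩ := hcofinal c hc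
      exact ⟨y, hy, hac.trans_le hcy⟩
  suffices h : ∃ E, IsClub E ∧ ∀ E', IsClub E' → ∃ γ ∈ S E, C E γ ⊆ E' by
    obtain ⟨E, hE, h⟩ := h
    refine ⟨C E, fun E' hE' => ?_⟩
    obtain ⟨γ, hγ, hsub⟩ := h E' hE'
    exact ⟨γ, hsub, hC E hE γ hγ⟩
  by_contra! hcon
  have hnext : ∀ E : Set T, ∃ E' : Set T, IsClub E' ∧
      (IsClub E → ∀ γ ∈ S E, ¬ C E γ ⊆ E') := by
    intro E
    by_cases hE : IsClub E
    · obtain ⟨E', hE', h⟩ := hcon E hE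
      exact ⟨E', hE', fun _ => h⟩
    · exact ⟨univ, .univ, fun h => absurd h hE⟩
  choose next hnextC hnext using hnext
  let W := (succ σ).ord.ToType
  have hWreg : (succ σ).IsRegular := isRegular_succ hσ.aleph0_le
  have hWc : #W = succ σ := mk_ord_toType _
  have hWcof : Order.cof W = succ σ := by rw [Ordinal.cof_toType, hWreg.cof_ord]
  have : NoMaxOrder W := noMaxOrder hWreg.aleph0_le
  let Φ : ∀ i : W, (∀ k, k < i → Set T) → Set T := fun i ih => ⋂ k : Iio i, next (ih k.1 k.2)
  let E : W → Set T := IsWellFounded.fix (· < ·) Φ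
  have hE (i : W) : E i = ⋂ k : Iio i, next (E k.1) := IsWellFounded.fix_eq (· < ·) Φ i
  have hsub (k i : W) (h : k < i) : E i ⊆ next (E k) := by
    rw [hE i]
    exact iInter_subset_of_subset ⟨k, h⟩ subset_rfl
  have hanti (k i : W) (h : k < i) : E i ⊆ E k := by
    rw [hE i, hE k]
    exact subset_iInter fun j => iInter_subset_of_subset ⟨j.1, j.2.trans h⟩ subset_rfl
  have hEclub (i : W) : IsClub (E i) := by
    rw [hE i]
    refine IsClub.iInter hcof0 ?_ fun k => hnextC _
    simpa [hcofT] using ((mk_set_le (Iio i)).trans_eq hWc).trans_lt hσT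
  have hEstar : IsClub (⋂ i, E i) := by
    refine IsClub.iInter hcof0 ?_ hEclub
    simpa [hcofT, hWc] using hσT
  obtain ⟨γ, hγc, hγ⟩ := exists_cof_Iio_eq_of_isClub hσ ((le_succ σ).trans_lt hσT) hEstar
  have hγS (i : W) : γ ∈ S (E i) := by
    refine ⟨hγc, fun x hx => ?_⟩
    obtain ⟨e, he, h⟩ := hγ x hx
    exact ⟨e, mem_iInter.1 he i, h⟩
  have hbad (b : Iio γ) : ∃ i : W, ∀ k, i < k → ∀ x, IsGreatest (E k ∩ Iic b.1) x →
      x ∈ next (E k) := by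
    -- As `k` grows, the greatest point of `E k` up to `b` can only descend. The smallest such point
    -- outside its `next` cannot be followed by another failure.
    by_cases hne : {x | ∃ k : W, IsGreatest (E k ∩ Iic b.1) x ∧ x ∉ next (E k)}.Nonempty
    · obtain ⟨i, hi, hi'⟩ := WellFounded.min_mem wellFounded_lt _ hne
      refine ⟨i, fun k hik x hx => by_contra fun hxn => ?_⟩
      refine WellFounded.not_lt_min wellFounded_lt
        (s := {x | ∃ k : W, IsGreatest (E k ∩ Iic b.1) x ∧ x ∉ next (E k)}) ⟨k, hx, hxn⟩ ?_
      refine lt_of_le_of_ne (hi.2 ⟨hanti i k hik hx.1.1, hx.1.2⟩) ?_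
      rintro heq
      rw [← heq] at hi'
      exact hi' (hsub i k hik hx.1.1)
    · have : Nonempty W := Ordinal.nonempty_toType_iff.2 (by simp)
      refine ⟨Classical.arbitrary W, fun k _ x hx => by_contra fun hxn => hne ⟨x, k, hx, hxn⟩⟩
  choose g hg using hbad
  -- Only σ many ladder points exist, so below σ⁺ there is one stage past which all of them have
  -- settled.
  have hbdd : BddAbove (range fun b : B γ => g b.1) := by
    refine .of_not_isCofinal fun h => (cof_le h).not_gt ?_
    rw [hWcof, lt_succ_iff]
    exact mk_range_le.trans (by rw [hBc, hγc])
  obtain ⟨i, hi⟩ := hbdd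
  obtain ⟨j, hij⟩ := exists_gt i
  refine hnext (E j) (hEclub j) γ (hγS j) ?_
  rintro x ⟨b, hb, hx⟩
  exact hg b j ((hi ⟨⟨b, hb⟩, rfl⟩).trans_lt hij) x hx

end WellOrders

/-! ### Slowly growing rank functions below a singular cardinal -/

section Scales

open Order Set

theorem Cardinal.IsRegular.isRegularCardinalOrder_toType {τ : Cardinal.{u}} (hτ : τ.IsRegular) :
    IsRegularCardinalOrder τ.ord.ToType :=
  ⟨by rw [Ordinal.type_toType, Ordinal.cof_toType, hτ.cof_ord]⟩

theorem mk_Iio_ord_toType_lt {c : Cardinal.{u}} (i : c.ord.ToType) : #(Iio i) < c := by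
  simpa using mk_Iio_lt i (by simp)

theorem Order.IsNormal.isClub_range_of_isCofinal {T K : Type u} [LinearOrder T] [WellFoundedLT T]
    [LinearOrder K] {f : T → K} (hf : IsNormal f) (hc : IsCofinal (range f)) :
    IsClub (range f) := by
  refine ⟨fun s hs hs0 _ a ha => ?_, hc⟩
  have hs' : f '' (f ⁻¹' s) = s := image_preimage_eq_of_subset hs
  obtain ⟨_, ⟨b, rfl⟩, hab⟩ := hc a
  obtain ⟨p, hp⟩ := exists_isLUB_of_bddAbove (s := f ⁻¹' s)
    ⟨b, fun x hx => hf.strictMono.le_iff_le.1 ((ha.1 hx).trans hab)⟩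
  have hlub := hf.map_isLUB hp (image_nonempty.1 (hs'.symm ▸ hs0))
  rw [hs'] at hlub
  exact ⟨p, hlub.unique ha⟩

theorem exists_strictMono_isCofinal_range (α : Type u) [LinearOrder α] [WellFoundedLT α] :
    ∃ g : (Order.cof α).ord.ToType → α, StrictMono g ∧ IsCofinal (range g) := by
  obtain ⟨s, hs, hs'⟩ := Ordinal.exists_ord_cof_eq α
  obtain ⟨e⟩ := Ordinal.type_eq.1 ((Ordinal.type_toType (Order.cof α).ord).trans hs'.symm)
  refine ⟨fun j => (e j).1, fun i j h => e.map_rel_iff.2 h, fun x => ?_⟩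
  obtain ⟨y, hy, hxy⟩ := hs x
  exact ⟨y, ⟨e.symm ⟨y, hy⟩, by simp⟩, hxy⟩

/-- Below the successor of a cardinal `κ`, all initial segments are increasing unions, of length the
cofinality of `κ`, of sets whose cardinalities are uniformly smaller than `κ`. -/
theorem exists_filtration {κ : Cardinal.{u}} (hκ : ℵ₀ ≤ κ) :
    ∃ (A : (succ κ).ord.ToType → κ.ord.cof.ord.ToType → Set (succ κ).ord.ToType)
      (m : κ.ord.cof.ord.ToType → Cardinal.{u}),
      (∀ ξ j, A ξ j ⊆ Iio ξ) ∧ (∀ ξ, Monotone (A ξ)) ∧ (∀ ξ, ∀ α < ξ, ∃ j, α ∈ A ξ j) ∧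
      (∀ j, m j < κ) ∧ ∀ ξ j, #(A ξ j) ≤ m j := by
  have := noMaxOrder hκ
  obtain ⟨g, hg, hgc⟩ : ∃ g : κ.ord.cof.ord.ToType → κ.ord.ToType,
      StrictMono g ∧ IsCofinal (range g) := by
    have := exists_strictMono_isCofinal_range κ.ord.ToType
    rwa [Ordinal.cof_toType] at this
  have he (ξ : (succ κ).ord.ToType) : Nonempty (Iio ξ ↪ κ.ord.ToType) := by
    rw [← Cardinal.le_def, mk_ord_toType, ← lt_succ_iff]
    exact mk_Iio_ord_toType_lt ξ
  refine ⟨fun ξ j => {α | ∃ h : α < ξ, (he ξ).some ⟨α, h⟩ < g j}, fun j => #(Iio (g j)),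
    ?_, ?_, ?_, ?_, ?_⟩
  · rintro ξ j α ⟨h, -⟩
    exact h
  · rintro ξ i j hij α ⟨h, h'⟩
    exact ⟨h, h'.trans_le (hg.monotone hij)⟩
  · intro ξ α h
    obtain ⟨x, hx⟩ := exists_gt ((he ξ).some ⟨α, h⟩)
    obtain ⟨_, ⟨j, rfl⟩, hj⟩ := hgc x
    exact ⟨j, h, hx.trans_le hj⟩
  · exact fun j => mk_Iio_ord_toType_lt _
  · intro ξ j
    refine mk_le_of_injective (f := fun x => ⟨(he ξ).some ⟨x.1, x.2.fst⟩, x.2.snd⟩)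
      fun x y h => ?_
    have := (he ξ).some.injective (Subtype.mk.inj h)
    exact Subtype.ext (Subtype.mk.inj this)

/-- A rank is a supremum of at most `m` successors of smaller ranks, and m⁺ is regular. This keeps
the rank functions below κ although their indices run through κ⁺. -/
theorem rank_lt_ord_succ {K : Type u} (r : K → K → Prop) [IsWellFounded K r] {m : Cardinal.{u}}
    (hm : ℵ₀ ≤ m) (h : ∀ b, #{a // r a b} ≤ m) (a : K) : IsWellFounded.rank r a < (succ m).ord := by
  induction a using IsWellFounded.induction r with
  | _ a ih =>
    rw [IsWellFounded.rank_eq]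
    refine Ordinal.iSup_lt_of_lt_cof ?_ fun b => ?_
    · rw [(isRegular_succ hm).cof_ord, lt_succ_iff]
      exact h a
    · exact (isSuccLimit_ord (hm.trans (le_succ m))).succ_lt (ih b.1 b.2)

/-- For a singular cardinal `κ` and `ν < κ` there are `κ⁺` functions from the cofinality of `κ`
to `κ` such that a set of cardinality at most `ν` is met cofinally often by at most `κ` of them. -/
theorem exists_not_isCofinal_setOf_frequently_mem {κ ν : Cardinal.{u}} (hκ : κ.IsSingular)
    (hν : ν < κ) :
    ∃ h : (succ κ).ord.ToType → κ.ord.cof.ord.ToType → Ordinal.{u}, (∀ ξ j, h ξ j < κ.ord) ∧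
      ∀ (ι : Type u) (t : ι → Ordinal.{u}), #ι ≤ ν →
        ¬ IsCofinal {ξ | ∀ i, ∃ j, i ≤ j ∧ h ξ j ∈ range t} := by
  have hκ0 : ℵ₀ ≤ κ := hκ.aleph0_le
  have hθreg : κ.ord.cof.IsRegular := isRegular_cof (isSuccLimit_ord hκ0)
  -- σ exceeds both ν and cf κ, for the final count; τ = σ⁺⁺ leaves the gap needed for guessing and
  -- stays below the limit cardinal κ.
  let σ := succ (max ν κ.ord.cof)
  let τ := succ (succ σ)
  have hσ0 : ℵ₀ ≤ max ν κ.ord.cof := hθreg.aleph0_le.trans (le_max_right _ _)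
  have hσreg : σ.IsRegular := isRegular_succ hσ0
  have hτreg : τ.IsRegular := isRegular_succ (hσreg.aleph0_le.trans (le_succ σ))
  have hσκ : σ < κ := hκ.isSuccLimit.succ_lt (max_lt hν hκ.cof_ord_lt)
  have hτκ : τ < κ := hκ.isSuccLimit.succ_lt (hκ.isSuccLimit.succ_lt hσκ)
  have hKreg : (succ κ).IsRegular := isRegular_succ hκ0
  let K := (succ κ).ord.ToType
  let J := κ.ord.cof.ord.ToType
  let T := τ.ord.ToType
  have hKcof : Order.cof K = succ κ := by rw [Ordinal.cof_toType, hKreg.cof_ord]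
  have hTcof : Order.cof T = τ := by rw [Ordinal.cof_toType, hτreg.cof_ord]
  have hTc : #T = τ := mk_ord_toType _
  have hTK : #T < Order.cof K := by rw [hTc, hKcof]; exact hτκ.trans (lt_succ κ)
  have : NoMaxOrder K := noMaxOrder hKreg.aleph0_le
  have : NoMaxOrder T := noMaxOrder hτreg.aleph0_le
  have : NoMaxOrder J := noMaxOrder hθreg.aleph0_le
  have : Nonempty K := Ordinal.nonempty_toType_iff.2 (by simp)
  have : Nonempty T := Ordinal.nonempty_toType_iff.2 (by simp [τ])
  have : Nonempty J := Ordinal.nonempty_toType_iff.2 hθreg.ord_pos.ne'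
  have := hτreg.isRegularCardinalOrder_toType
  obtain ⟨C, hC⟩ := exists_club_guessing (T := T) hσreg (hTc ▸ lt_succ (succ σ))
  obtain ⟨A, m, hA, hAmono, hAex, hm, hAm⟩ := exists_filtration hκ0
  have hE (ξ : K) : ∃ E ⊆ Iio ξ, #E ≤ τ ∧
      (Order.cof (Iio ξ) = τ → IsClub {x : Iio ξ | x.1 ∈ E}) := by
    by_cases hξ : Order.cof (Iio ξ) = τ
    · have hl : IsSuccLimit ξ := isSuccLimit_of_aleph0_le_cof_Iio (hξ ▸ hτreg.aleph0_le)
      have := hl.isSuccPrelimit.noMaxOrder_Iio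
      obtain ⟨E, hE, hEc⟩ := exists_isClub_mk_le_cof (Iio ξ)
      refine ⟨Subtype.val '' E, ?_, mk_image_le.trans (hEc.trans_eq hξ), fun _ => ?_⟩
      · rintro _ ⟨x, -, rfl⟩
        exact x.2
      · rwa [show {x : Iio ξ | x.1 ∈ Subtype.val '' E} = E from
        Subtype.val_injective.preimage_image E]
    · exact ⟨∅, empty_subset _, by simp, fun h => absurd h hξ⟩
  choose E hEsub hEτ hEclub using hE
  -- The part `A` makes `h α` eventually smaller than `h ξ` for all α < ξ; the part `E` makes it
  -- smaller at every coordinate for α in a club of ξ.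
  let r : J → K → K → Prop := fun j α ξ => α ∈ A ξ j ∪ E ξ
  have hr (j : J) : IsWellFounded K (r j) :=
    ⟨Subrelation.wf (fun {a b} h => h.elim (fun h => hA _ _ h) fun h => hEsub _ h)
      (wellFounded_lt (α := K))⟩
  let h : K → J → Ordinal.{u} := fun ξ j => IsWellFounded.rank (r j) ξ
  have hhE {α ξ : K} (hα : α ∈ E ξ) (j : J) : h α j < h ξ j :=
    IsWellFounded.rank_lt_of_rel (r := r j) (Or.inr hα)
  have hhlt {α ξ : K} (hα : α < ξ) : ∃ i : J, ∀ j, i ≤ j → h α j < h ξ j := by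
    obtain ⟨i, hi⟩ := hAex ξ α hα
    exact ⟨i, fun j hij => IsWellFounded.rank_lt_of_rel (r := r j) (Or.inl (hAmono ξ hij hi))⟩
  refine ⟨h, fun ξ j => ?_, ?_⟩
  · have hM : ℵ₀ ≤ max (m j) τ := hτreg.aleph0_le.trans (le_max_right _ _)
    refine (rank_lt_ord_succ (r j) hM (fun b => ?_) ξ).trans_le ?_
    · refine (mk_union_le (A b j) (E b)).trans ?_
      exact add_le_of_le hM ((hAm b j).trans (le_max_left _ _))
        ((hEτ b).trans (le_max_right _ _))
    · exact ord_le_ord.2 (succ_le_of_lt (max_lt (hm j) hτκ))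
  intro ι t hι hY
  let Q : Set K → K → Prop := fun X ζ => ∃ i : J, ∀ j, i ≤ j → ∀ x ∈ X, h x j < h ζ j
  -- `Z X` is an eventual bound for all of `X` from one common index, whenever such a bound exists;
  -- otherwise it is arbitrary.
  have hZ (X : Set K) : ∃ ζ, (∃ ζ', Q X ζ') → Q X ζ := by
    by_cases hX : ∃ ζ', Q X ζ'
    · exact ⟨hX.choose, fun _ => hX.choose_spec⟩
    · exact ⟨Classical.arbitrary K, fun h => absurd h hX⟩
  choose Z hZ using hZ
  have hN (s : T → K) : ∃ N, ∀ γ, s γ < N := by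
    obtain ⟨b, hb⟩ : BddAbove (range s) :=
      .of_not_isCofinal fun hg => (cof_le hg).not_gt (mk_range_le.trans_lt hTK)
    obtain ⟨N, hN⟩ := exists_gt b
    exact ⟨N, fun γ => (hb ⟨γ, rfl⟩).trans_lt hN⟩
  choose N hN using hN
  choose P hPY hP using hY
  -- The useful γ is known only after the sequence is complete, so each step passes the bounds `Z`
  -- for all γ at once and then a member of the supposedly cofinal set.
  obtain ⟨ξ, hξ, hξF⟩ := exists_isNormal_forall_lt hTK (fun a (x : Iic a → K) =>
    P (N fun γ => Z {k | ∃ c : Iic a, c.1 ∈ C γ ∧ x c = k}))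
  let X : T → T → Set K := fun γ a => {k | ∃ c : Iic a, c.1 ∈ C γ ∧ ξ c = k}
  let y : T → K := fun a => P (N fun γ => Z (X γ a))
  have hyξ (a b : T) (hab : a < b) : y a < ξ b := hξF a b hab
  have hZy (γ a : T) : Z (X γ a) < y a := (hN (fun γ => Z (X γ a)) γ).trans_le (hP _)
  have hyY (a : T) := hPY (N fun γ => Z (X γ a))
  obtain ⟨δ, hδ⟩ := exists_isLUB_of_bddAbove (s := range ξ)
    (.of_not_isCofinal fun hg => (cof_le hg).not_gt (mk_range_le.trans_lt hTK))
  have hξδ (a : T) : ξ a < δ := by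
    obtain ⟨b, hb⟩ := exists_gt a
    exact (hξ.strictMono hb).trans_le (hδ.1 ⟨b, rfl⟩)
  let ξ' : T → Iio δ := fun a => ⟨ξ a, hξδ a⟩
  have hξ'mono : StrictMono ξ' := fun a b hab => hξ.strictMono hab
  have hξ'cof : IsCofinal (range ξ') := by
    rintro ⟨x, hx⟩
    obtain ⟨_, ⟨a, rfl⟩, ha⟩ := (lt_isLUB_iff hδ).1 hx
    exact ⟨_, ⟨a, rfl⟩, ha.le⟩
  have hξ' : IsNormal ξ' := ⟨hξ'mono, fun {a} ha v hv => hξ.2 ha (by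
    rintro _ ⟨b, hb, rfl⟩
    exact hv ⟨b, hb, rfl⟩)⟩
  have hδcof : Order.cof (Iio δ) = τ := (cof_congr_of_strictMono hξ'mono hξ'cof).symm.trans hTcof
  have hclub : IsClub {a : T | ξ a ∈ E δ} := by
    have hEδ := hEclub δ hδcof
    have hR : IsClub (range ξ') := hξ'.isClub_range_of_isCofinal hξ'cof
    have hinter := IsClub.inter (by
      rw [hδcof]
      exact (hσreg.aleph0_le.trans_lt ((lt_succ σ).trans (lt_succ _))).ne') hEδ hR
    refine ⟨fun s hs hs0 _ a ha => ?_, fun a => ?_⟩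
    · refine hEδ.isLUB_mem (t := ξ' '' s) ?_ (hs0.image _) (hξ'.map_isLUB ha hs0)
      rintro _ ⟨b, hb, rfl⟩
      exact hs hb
    · obtain ⟨_, ⟨hb, b, rfl⟩, hab⟩ := hinter.isCofinal (ξ' a)
      exact ⟨b, hb, hξ'mono.le_iff_le.1 hab⟩
  obtain ⟨γ, hγE, hγσ, hγmax⟩ := hC _ hclub
  have hstep (a : C γ) : ∃ i : J, (∀ j, i ≤ j → ∀ c ∈ C γ, c ≤ a → h (ξ c) j < h (y a) j) ∧
      ∀ j, i ≤ j → ∀ b ∈ C γ, a.1 < b → ∃ c ∈ C γ, c ≤ b ∧ h (y a) j < h (ξ c) j := by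
    -- Since the guessed points lie in `E δ`, the supremum δ itself is a uniform bound, which makes
    -- `Z (X γ a)` a genuine one.
    have hQ : Q (X γ a) δ := by
      refine ⟨Classical.arbitrary J, fun j _ x hx => ?_⟩
      obtain ⟨c, hc, rfl⟩ := hx
      exact hhE (hγE hc) j
    obtain ⟨i₁, hi₁⟩ := hZ _ ⟨δ, hQ⟩
    obtain ⟨i₂, hi₂⟩ := hhlt (hZy γ a)
    have hne : (C γ ∩ Ioi a.1).Nonempty := hγmax a.1 a.2
    obtain ⟨hs, has⟩ := WellFounded.min_mem wellFounded_lt _ hne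
    obtain ⟨i₃, hi₃⟩ := hhlt (hyξ _ _ has)
    refine ⟨max i₁ (max i₂ i₃), fun j hj c hc hca => ?_, fun j hj b hb hab => ?_⟩
    · exact (hi₁ j ((le_max_left _ _).trans hj) _ ⟨⟨c, hca⟩, hc, rfl⟩).trans
        (hi₂ j ((le_max_left _ _).trans ((le_max_right _ _).trans hj)))
    · exact ⟨_, hs, WellFounded.min_le wellFounded_lt (s := C γ ∩ Ioi a.1) ⟨hb, hab⟩,
        hi₃ j ((le_max_right _ _).trans ((le_max_right _ _).trans hj))⟩
  choose i hi₁ hi₂ using hstep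
  choose j hij hj using fun a : C γ => hyY a.1 (i a)
  choose s hs using hj
  have hlt (a b : C γ) (hab : a.1 < b.1) (hjab : j a = j b) :
      h (y a) (j a) < h (y b) (j b) := by
    obtain ⟨c, hc, hcb, hac⟩ := hi₂ a (j a) (hij a) b.1 b.2 hab
    rw [hjab] at hac ⊢
    exact hac.trans (hi₁ b (j b) (hij b) c hc hcb)
  -- At a common coordinate the values `h (y a)` strictly increase along `C γ`, so coordinate and
  -- value determine `a`. That leaves fewer than σ possibilities.
  have hinj : Function.Injective fun a : C γ => (j a, s a) := by
    intro a b hab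
    obtain ⟨hjab, hsab⟩ := Prod.mk.inj hab
    have heq : h (y a) (j a) = h (y b) (j b) := by rw [← hs a, ← hs b, hsab]
    rcases lt_trichotomy a.1 b.1 with hlt' | heq' | hlt'
    · exact absurd heq (hlt a b hlt' hjab).ne
    · exact Subtype.ext heq'
    · exact absurd heq (hlt b a hlt' hjab.symm).ne'
  have hcard := hγσ.trans (mk_le_of_injective hinj)
  refine hcard.not_gt (lt_succ_iff.2 ?_)
  rw [mk_prod, lift_id, lift_id, mk_ord_toType]
  exact mul_le_of_le hσ0 (le_max_right _ _) (hι.trans (le_max_left _ _))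

end Scales

/-! ### Regularity of ultrafilters at singular cardinals -/

section RegularUltrafilters

open Order Set Filter

variable {I : Type u} {D : Ultrafilter I}

theorem RegularUltrafilter.of_eventually {lam μ : Cardinal.{u}} (hlam : 0 < lam) {A : Type u}
    (hA : μ ≤ #A) (f : I → Set A) (hf : ∀ᶠ i in D, #(f i) < lam)
    (hfD : ∀ α : A, ∀ᶠ i in D, α ∈ f i) : RegularUltrafilter lam μ D := by
  classical
  obtain ⟨e⟩ : Nonempty (μ.out ↪ A) := by rwa [← Cardinal.le_def, mk_out]
  refine ⟨fun i => if #(f i) < lam then e ⁻¹' f i else ∅, fun i => ?_, fun α => ?_⟩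
  · dsimp only
    split_ifs with h
    · exact (mk_preimage_of_injective _ _ e.injective).trans_lt h
    · simpa using hlam
  · filter_upwards [hf, hfD (e α)] with i hi hα
    simpa [hi] using hα

theorem RegularUltrafilter.exists_of_mk_le {lam μ : Cardinal.{u}}
    (h : RegularUltrafilter lam μ D) {A : Type u} (hA : #A ≤ μ) :
    ∃ f : I → Set A, (∀ i, #(f i) < lam) ∧ ∀ α : A, ∀ᶠ i in D, α ∈ f i := by
  obtain ⟨f, hf, hfD⟩ := h
  obtain ⟨e⟩ : Nonempty (A ↪ μ.out) := by rwa [← Cardinal.le_def, mk_out]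
  exact ⟨fun i => e ⁻¹' f i, fun i => (mk_preimage_of_injective _ _ e.injective).trans_lt (hf i),
    fun α => hfD (e α)⟩

/-- For regular `ρ`, an ultrafilter is `(ρ, ρ)`-regular if and only if there is a function to `ρ`
which is unbounded modulo the ultrafilter. -/
theorem regularUltrafilter_self_iff {ρ : Cardinal.{u}} (hρ : ρ.IsRegular) :
    RegularUltrafilter ρ ρ D ↔ ∃ F : I → ρ.ord.ToType, ∀ β, ∀ᶠ i in D, β < F i := by
  have := noMaxOrder hρ.aleph0_le
  constructor
  · intro h
    obtain ⟨f, hf, hfD⟩ := h.exists_of_mk_le (A := ρ.ord.ToType) (mk_ord_toType ρ).le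
    have hb (i : I) : ∃ x, ∀ y ∈ f i, y < x :=
      not_isCofinal_iff.1 fun hc => (Order.cof_le hc).not_gt (by
        rw [Ordinal.cof_toType, hρ.cof_ord]
        exact hf i)
    choose F hF using hb
    exact ⟨F, fun β => (hfD β).mono fun i hi => hF i β hi⟩
  · rintro ⟨F, hF⟩
    exact .of_eventually hρ.pos (mk_ord_toType ρ).ge (fun i => Iio (F i))
      (.of_forall fun i => mk_Iio_ord_toType_lt _) hF

/-- This is how failure of regularity at cf κ is exploited: choices of an index below cf κ can be
bounded uniformly on a set in `D`. -/
theorem eventually_le_of_not_regularUltrafilter {ρ : Cardinal.{u}} (hρ : ρ.IsRegular)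
    (h : ¬ RegularUltrafilter ρ ρ D) (F : I → ρ.ord.ToType) : ∃ β, ∀ᶠ i in D, F i ≤ β := by
  rw [regularUltrafilter_self_iff hρ] at h
  push Not at h
  obtain ⟨β, hβ⟩ := h F
  exact ⟨β, hβ⟩

theorem exists_monotone_cofinal_cardinal {κ : Cardinal.{u}} :
    ∃ m : κ.ord.cof.ord.ToType → Cardinal.{u}, Monotone m ∧ (∀ j, m j < κ) ∧
      ∀ c < κ, ∃ j, c ≤ m j := by
  obtain ⟨g, hg, hgc⟩ : ∃ g : κ.ord.cof.ord.ToType → κ.ord.ToType,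
      StrictMono g ∧ IsCofinal (range g) := by
    have := exists_strictMono_isCofinal_range κ.ord.ToType
    rwa [Ordinal.cof_toType] at this
  refine ⟨fun j => #(Iio (g j)), fun i j hij => mk_le_mk_of_subset
    (Iio_subset_Iio (hg.monotone hij)), fun j => mk_Iio_ord_toType_lt _, fun c hc => ?_⟩
  have hlt : c.ord < Ordinal.type (α := κ.ord.ToType) (· < ·) := by
    rw [Ordinal.type_toType]
    exact ord_lt_ord.2 hc
  obtain ⟨_, ⟨j, rfl⟩, hj⟩ := hgc (Ordinal.enum (· < ·) ⟨c.ord, hlt⟩)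
  refine ⟨j, le_trans (le_of_eq ?_) (mk_le_mk_of_subset (Iio_subset_Iio hj))⟩
  have h := Ordinal.card_typein (α := κ.ord.ToType) (r := (· < ·))
    (Ordinal.enum (α := κ.ord.ToType) (· < ·) ⟨c.ord, hlt⟩)
  rw [Ordinal.typein_enum, card_ord] at h
  exact h

/-- If `D` is regular at the cofinality of `κ`, then `D` is regular at `κ`. -/
theorem RegularUltrafilter.of_cof {κ : Cardinal.{u}} (hκ : ℵ₀ ≤ κ)
    (h : RegularUltrafilter κ.ord.cof κ.ord.cof D) : RegularUltrafilter κ κ D := by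
  have hθ : κ.ord.cof.IsRegular := isRegular_cof (isSuccLimit_ord hκ)
  have := noMaxOrder hκ
  obtain ⟨F, hF⟩ := (regularUltrafilter_self_iff hθ).1 h
  obtain ⟨g, hg, hgc⟩ : ∃ g : κ.ord.cof.ord.ToType → κ.ord.ToType,
      StrictMono g ∧ IsCofinal (range g) := by
    have := exists_strictMono_isCofinal_range κ.ord.ToType
    rwa [Ordinal.cof_toType] at this
  refine .of_eventually (aleph0_pos.trans_le hκ) (mk_ord_toType κ).ge (fun i => Iio (g (F i)))
    (.of_forall fun i => mk_Iio_ord_toType_lt _) fun α => ?_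
  obtain ⟨_, ⟨j, rfl⟩, hj⟩ := hgc α
  exact (hF j).mono fun i hi => hj.trans_lt (hg hi)

/-- If `D` is regular at `κ⁺` but not at the cofinality of `κ`, then `D` is regular at `κ`. -/
theorem RegularUltrafilter.of_succ {κ : Cardinal.{u}} (hκ : ℵ₀ ≤ κ)
    (h : RegularUltrafilter (succ κ) (succ κ) D)
    (hθ : ¬ RegularUltrafilter κ.ord.cof κ.ord.cof D) : RegularUltrafilter κ κ D := by
  have hθreg : κ.ord.cof.IsRegular := isRegular_cof (isSuccLimit_ord hκ)
  have hKreg : (succ κ).IsRegular := isRegular_succ hκ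
  obtain ⟨F, hF⟩ := (regularUltrafilter_self_iff hKreg).1 h
  obtain ⟨A, m, -, hAmono, hAex, hm, hAm⟩ := exists_filtration hκ
  have hne : Nonempty κ.ord.cof.ord.ToType := Ordinal.nonempty_toType_iff.2 hθreg.ord_pos.ne'
  have hj (α : (succ κ).ord.ToType) : ∃ j, ∀ᶠ i in D, α ∈ A (F i) j := by
    have hc (i : I) : ∃ j, α < F i → α ∈ A (F i) j := by
      by_cases hα : α < F i
      · obtain ⟨j, hj⟩ := hAex _ _ hα
        exact ⟨j, fun _ => hj⟩
      · exact ⟨Classical.arbitrary _, fun h => absurd h hα⟩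
    choose G hG using hc
    obtain ⟨j, hj⟩ := eventually_le_of_not_regularUltrafilter hθreg hθ G
    refine ⟨j, ?_⟩
    filter_upwards [hj, hF α] with i hi hi'
    exact hAmono _ hi (hG i hi')
  choose j hj using hj
  -- κ⁺ many points share one level `b`, where every set of the filtration has size at most `m b` <
  -- κ.
  obtain ⟨b, hb⟩ := infinite_pigeonhole_card j (succ κ) (mk_ord_toType _).ge hKreg.aleph0_le (by
    rw [hKreg.cof_ord, mk_ord_toType, lt_succ_iff]
    exact Ordinal.cof_ord_le κ)
  refine .of_eventually (aleph0_pos.trans_le hκ) (A := j ⁻¹' {b}) ((le_succ κ).trans hb)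
    (fun i => Subtype.val ⁻¹' A (F i) b) (.of_forall fun i => ?_) ?_
  · exact ((mk_preimage_of_injective _ _ Subtype.val_injective).trans (hAm _ b)).trans_lt (hm b)
  · rintro ⟨α, rfl⟩
    exact hj α

/-- If `κ` is singular and `D` is regular at `κ` but not at the cofinality of `κ`, then `D` is
regular at `κ⁺`. -/
theorem RegularUltrafilter.succ_of_isSingular {κ : Cardinal.{u}} (hκ : κ.IsSingular)
    (h : RegularUltrafilter κ κ D) (hθ : ¬ RegularUltrafilter κ.ord.cof κ.ord.cof D) :
    RegularUltrafilter (succ κ) (succ κ) D := by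
  have hθreg : κ.ord.cof.IsRegular := isRegular_cof (isSuccLimit_ord hκ.aleph0_le)
  have hKreg : (succ κ).IsRegular := isRegular_succ hκ.aleph0_le
  obtain ⟨f, hf, hfD⟩ := h.exists_of_mk_le (A := κ.ord.ToType) (mk_ord_toType κ).le
  obtain ⟨m, hmono, hm, hmc⟩ := exists_monotone_cofinal_cardinal (κ := κ)
  choose F hF using fun i => hmc _ (hf i)
  obtain ⟨b, hb⟩ := eventually_le_of_not_regularUltrafilter hθreg hθ F
  obtain ⟨g, hgκ, hg⟩ := exists_not_isCofinal_setOf_frequently_mem hκ (hm b)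
  let t : ∀ i, f i → Ordinal.{u} := fun i x => (Ordinal.ToType.mk.symm x.1).1
  refine .of_eventually hKreg.pos (mk_ord_toType _).ge
    (fun i => {ξ | ∀ a, ∃ j, a ≤ j ∧ g ξ j ∈ range (t i)}) ?_ fun ξ => ?_
  · filter_upwards [hb] with i hi
    obtain ⟨x, hx⟩ := not_isCofinal_iff.1 (hg _ (t i) ((hF i).trans (hmono hi)))
    exact (mk_le_mk_of_subset hx).trans_lt (mk_Iio_ord_toType_lt x)
  · by_contra hcon
    -- Otherwise `g ξ` eventually avoids `f i` for most `i`, from a common index `a` on; but the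
    -- single point `g ξ a` lies in `f i` for most `i`.
    have hcon' := Ultrafilter.eventually_not.2 hcon
    have hne : Nonempty κ.ord.cof.ord.ToType := Ordinal.nonempty_toType_iff.2 hθreg.ord_pos.ne'
    have hc (i : I) : ∃ a, (¬ ∀ a, ∃ j, a ≤ j ∧ g ξ j ∈ range (t i)) →
        ∀ j, a ≤ j → g ξ j ∉ range (t i) := by
      by_cases hi : ∀ a, ∃ j, a ≤ j ∧ g ξ j ∈ range (t i)
      · exact ⟨Classical.arbitrary _, fun h => absurd hi h⟩
      · push Not at hi
        obtain ⟨a, ha⟩ := hi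
        exact ⟨a, fun _ => ha⟩
    choose G hG using hc
    obtain ⟨a, ha⟩ := eventually_le_of_not_regularUltrafilter hθreg hθ G
    obtain ⟨i, hi, hi', hi''⟩ :=
      (hcon'.and (ha.and (hfD (Ordinal.ToType.mk ⟨g ξ a, hgκ ξ a⟩)))).exists
    exact hG i hi a hi' ⟨⟨_, hi''⟩, by simp [t]⟩

/-- A characterization of regularity of ultrafilters at singular cardinals in terms of regularity
at two regular cardinals. -/
theorem regularUltrafilter_iff_of_isSingular {κ : Cardinal.{u}} (hκ : κ.IsSingular) :
    RegularUltrafilter κ κ D ↔ RegularUltrafilter κ.ord.cof κ.ord.cof D ∨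
      RegularUltrafilter (succ κ) (succ κ) D := by
  refine ⟨fun h => ?_, fun h => ?_⟩
  · by_cases hθ : RegularUltrafilter κ.ord.cof κ.ord.cof D
    · exact .inl hθ
    · exact .inr (h.succ_of_isSingular hκ hθ)
  · by_cases hθ : RegularUltrafilter κ.ord.cof κ.ord.cof D
    · exact hθ.of_cof hκ.aleph0_le
    · exact (h.resolve_left hθ).of_succ hκ.aleph0_le hθ

end RegularUltrafilters

/-! ### Productive compactness as compactness along one ultrafilter -/

section UltrafilterCompactness

open Set Filter Topology

/-- A space is `D`-compact if every sequence indexed by the underlying set of `D` has a limit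
along `D`. -/
def UltrafilterCompact {I : Type u} (D : Ultrafilter I) (X : Type u) [TopologicalSpace X] : Prop :=
  ∀ x : I → X, ∃ y, Tendsto x D (𝓝 y)

variable {I : Type u} {D : Ultrafilter I}

theorem UltrafilterCompact.pi {J : Type u} {X : J → Type u} [∀ j, TopologicalSpace (X j)]
    (h : ∀ j, UltrafilterCompact D (X j)) : UltrafilterCompact D (∀ j, X j) := by
  intro x
  choose y hy using fun j => h j fun i => x i j
  exact ⟨y, tendsto_pi_nhds.2 hy⟩

theorem UltrafilterCompact.sum {X Y : Type u} [TopologicalSpace X] [TopologicalSpace Y]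
    (hX : UltrafilterCompact D X) (hY : UltrafilterCompact D Y) : UltrafilterCompact D (X ⊕ Y) := by
  intro x
  rcases Ultrafilter.em D fun i => ∃ a, x i = Sum.inl a with h | h
  · obtain ⟨_, a₀, -⟩ := h.exists
    have hc (i : I) : ∃ a, (∃ a, x i = Sum.inl a) → x i = Sum.inl a := by
      by_cases hi : ∃ a, x i = Sum.inl a
      · exact ⟨hi.choose, fun _ => hi.choose_spec⟩
      · exact ⟨a₀, fun h => absurd h hi⟩
    choose a ha using hc
    obtain ⟨y, hy⟩ := hX a
    exact ⟨Sum.inl y, ((continuous_inl.tendsto y).comp hy).congr'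
      (h.mono fun i hi => (ha i hi).symm)⟩
  · have h' : ∀ᶠ i in D, ∃ b, x i = Sum.inr b := h.mono fun i hi => by
      rcases hx : x i with a | b
      · exact absurd ⟨a, hx⟩ hi
      · exact ⟨b, rfl⟩
    obtain ⟨_, b₀, -⟩ := h'.exists
    have hc (i : I) : ∃ b, (∃ b, x i = Sum.inr b) → x i = Sum.inr b := by
      by_cases hi : ∃ b, x i = Sum.inr b
      · exact ⟨hi.choose, fun _ => hi.choose_spec⟩
      · exact ⟨b₀, fun h => absurd h hi⟩
    choose b hb using hc
    obtain ⟨y, hy⟩ := hY b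
    exact ⟨Sum.inr y, ((continuous_inr.tendsto y).comp hy).congr'
      (h'.mono fun i hi => (hb i hi).symm)⟩

theorem UltrafilterCompact.of_isClosedEmbedding {X Y : Type u} [TopologicalSpace X]
    [TopologicalSpace Y] {e : X → Y} (he : IsClosedEmbedding e) (hY : UltrafilterCompact D Y) :
    UltrafilterCompact D X := by
  intro x
  obtain ⟨y, hy⟩ := hY (e ∘ x)
  obtain ⟨z, rfl⟩ := he.isClosed_range.mem_of_tendsto hy (.of_forall fun i => ⟨x i, rfl⟩)
  exact ⟨z, he.isInducing.tendsto_nhds_iff.2 hy⟩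

/-- If no small subfamily covers, choose `x i` outside the members listed in `f i`. A limit lies in
some `U` of the cover, yet `U` is listed for most `i`. -/
theorem UltrafilterCompact.intervalCompact {lam μ : Cardinal.{u}}
    (hD : RegularUltrafilter lam μ D) {X : Type u} [TopologicalSpace X]
    (hX : UltrafilterCompact D X) : IntervalCompact lam μ X := by
  intro 𝒰 hopen hcover hcard
  obtain ⟨f, hf, hfD⟩ := hD.exists_of_mk_le hcard
  by_contra! hcon
  have hx (i : I) : ∃ x : X, ∀ U ∈ f i, x ∉ U.1 := by
    have h := hcon (Subtype.val '' f i) (by simp) (mk_image_le.trans_lt (hf i))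
    obtain ⟨x, hx⟩ := (ne_univ_iff_exists_notMem _).1 h
    exact ⟨x, fun U hU hxU => hx ⟨U.1, ⟨U, hU, rfl⟩, hxU⟩⟩
  choose x hx using hx
  obtain ⟨y, hy⟩ := hX x
  obtain ⟨U, hU, hyU⟩ := (hcover ▸ mem_univ y : y ∈ ⋃₀ 𝒰)
  obtain ⟨i, hi, hi'⟩ := ((hy.eventually ((hopen U hU).mem_nhds hyU)).and (hfD ⟨U, hU⟩)).exists
  exact hx i ⟨U, hU⟩ hi' hi

theorem UltrafilterCompact.familyProductivelyCompact {lam μ : Cardinal.{u}}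
    (hD : RegularUltrafilter lam μ D) {ι : Type u} {X : ι → Type u} [∀ i, TopologicalSpace (X i)]
    (hX : ∀ i, UltrafilterCompact D (X i)) : FamilyProductivelyCompact lam μ X :=
  fun _ g => (UltrafilterCompact.pi fun j => hX (g j)).intervalCompact hD

theorem UltrafilterCompact.productivelyCompact {lam μ : Cardinal.{u}}
    (hD : RegularUltrafilter lam μ D) {X : Type u} [TopologicalSpace X]
    (hX : UltrafilterCompact D X) : ProductivelyCompact lam μ X :=
  fun _ => (UltrafilterCompact.pi fun _ => hX).intervalCompact hD

theorem mk_biUnion_finset_lt {A : Type u} {lam : Cardinal.{u}} (hlam : ℵ₀ ≤ lam)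
    {s : Set (Finset A)} (hs : #s < lam) : #(⋃ F ∈ s, (F : Set A) : Set A) < lam := by
  rcases lt_or_ge #s ℵ₀ with h | h
  · refine lt_of_lt_of_le ?_ hlam
    rw [lt_aleph0_iff_set_finite] at h ⊢
    exact h.biUnion fun F _ => F.finite_toSet
  · refine ((mk_biUnion_le (fun F : Finset A => (F : Set A)) s).trans ?_).trans_lt hs
    refine mul_le_of_le h le_rfl (ciSup_le' fun F => ?_)
    exact (Finset.finite_toSet F.1).lt_aleph0.le.trans h

/-- If a space is `[lam, μ]`-compact then every family of points indexed by the small subsets of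
`μ` converges along some ultrafilter containing all cones. -/
theorem IntervalCompact.exists_ultrafilter_tendsto {lam μ : Cardinal.{u}} (hlam : ℵ₀ ≤ lam)
    (hμ : ℵ₀ ≤ μ) {A : Type u} (hA : #A = μ) {X : Type u} [TopologicalSpace X]
    (hX : IntervalCompact lam μ X) (x : {s : Set A // #s < lam} → X) :
    ∃ (D : Ultrafilter {s : Set A // #s < lam}) (y : X),
      (∀ α : A, {s | α ∈ s.1} ∈ D) ∧ Tendsto x D (𝓝 y) := by
  have : Infinite A := infinite_iff.2 (hA ▸ hμ)
  -- Finite sets keep the cover at size μ. Fewer than λ of them have a union of size below λ, and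
  -- the point indexed by that union escapes all the corresponding `V F`.
  let V : Finset A → Set X := fun F => (closure (x '' {s | (F : Set A) ⊆ s.1}))ᶜ
  obtain ⟨y, hy⟩ : ∃ y, ∀ F, y ∉ V F := by
    by_contra! hcon
    obtain ⟨𝒱, h𝒱, hcard, hcov⟩ := hX (range V)
      (by
        rintro _ ⟨F, rfl⟩
        exact isClosed_closure.isOpen_compl)
      (by simpa [eq_univ_iff_forall] using hcon)
      (mk_range_le.trans (by rw [mk_finset_of_infinite, hA]))
    choose F hF using h𝒱
    let S : Set (Finset A) := range fun U : 𝒱 => F U.2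
    have hS : #(⋃ F ∈ S, (F : Set A) : Set A) < lam :=
      mk_biUnion_finset_lt hlam (mk_range_le.trans_lt hcard)
    obtain ⟨U, hU, hxU⟩ := (hcov ▸ mem_univ (x ⟨_, hS⟩) : x ⟨_, hS⟩ ∈ ⋃₀ 𝒱)
    rw [← hF hU] at hxU
    refine hxU (subset_closure ⟨_, ?_, rfl⟩)
    exact subset_biUnion_of_mem (u := fun F : Finset A => (F : Set A)) ⟨⟨U, hU⟩, rfl⟩
  let L : Filter {s : Set A // #s < lam} :=
    comap x (𝓝 y) ⊓ ⨅ F : Finset A, 𝓟 {s | (F : Set A) ⊆ s.1}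
  have hdir : Directed (· ≥ ·) fun F : Finset A =>
      𝓟 {s : {s : Set A // #s < lam} | (F : Set A) ⊆ s.1} := by
    classical
    intro F G
    exact ⟨F ∪ G, principal_mono.2 fun s hs => subset_trans (by simp) (mem_ofPred.1 hs),
      principal_mono.2 fun s hs => subset_trans (by simp) (mem_ofPred.1 hs)⟩
  have hL : NeBot L := by
    rw [inf_neBot_iff]
    intro s hs t ht
    obtain ⟨F, hF⟩ := (mem_iInf_of_directed hdir t).1 ht
    obtain ⟨O, hO, hOs⟩ := mem_comap.1 hs
    obtain ⟨_, hzO, z, hz, rfl⟩ := mem_closure_iff_nhds.1 (not_not.1 (hy F)) O hO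
    exact ⟨z, hOs hzO, hF hz⟩
  refine ⟨Ultrafilter.of L, y, fun α => ?_, ?_⟩
  · have h1 : {s : {s : Set A // #s < lam} | (({α} : Finset A) : Set A) ⊆ s.1} ∈ L :=
      mem_inf_of_right (mem_iInf_of_mem {α} (mem_principal_self _))
    filter_upwards [Ultrafilter.of_le L h1] with s hs
    simpa using hs
  · exact tendsto_iff_comap.2 ((Ultrafilter.of_le L).trans inf_le_left)

/-- A productively `[lam, μ]`-compact family is `D`-compact for some `(lam, μ)`-regular
ultrafilter `D`. -/
theorem FamilyProductivelyCompact.exists_ultrafilterCompact {lam μ : Cardinal.{u}}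
    (hlam : ℵ₀ ≤ lam) (hμ : ℵ₀ ≤ μ) {ι : Type u} {X : ι → Type u} [∀ i, TopologicalSpace (X i)]
    (hX : FamilyProductivelyCompact lam μ X) :
    ∃ (I : Type u) (D : Ultrafilter I), RegularUltrafilter lam μ D ∧
      ∀ i, UltrafilterCompact D (X i) := by
  let I := {s : Set μ.out // #s < lam}
  let J := {D : Ultrafilter I // ∀ α : μ.out, {s | α ∈ s.1} ∈ D}
  suffices h : ∃ D : J, ∀ i, UltrafilterCompact D.1 (X i) by
    obtain ⟨D, hD⟩ := h
    exact ⟨I, D.1, ⟨Subtype.val, fun s => s.2, D.2⟩, hD⟩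
  -- The product has one factor per candidate `D`, carrying a sequence without `D`-limit. A limit of
  -- the joint sequence along some `D` contradicts coordinate `D`.
  by_contra! hcon
  choose g hg using hcon
  simp only [UltrafilterCompact, not_forall, not_exists] at hg
  choose x hx using hg
  obtain ⟨D, y, hD, hy⟩ := (hX J g).exists_ultrafilter_tendsto hlam hμ (mk_out μ)
    fun s j => x j s
  exact hx ⟨D, hD⟩ (y ⟨D, hD⟩) (tendsto_pi_nhds.1 hy ⟨D, hD⟩)

theorem ProductivelyCompact.exists_ultrafilterCompact {lam μ : Cardinal.{u}}
    (hlam : ℵ₀ ≤ lam) (hμ : ℵ₀ ≤ μ) {X : Type u} [TopologicalSpace X]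
    (hX : ProductivelyCompact lam μ X) :
    ∃ (I : Type u) (D : Ultrafilter I), RegularUltrafilter lam μ D ∧ UltrafilterCompact D X := by
  obtain ⟨I, D, hD, h⟩ := FamilyProductivelyCompact.exists_ultrafilterCompact hlam hμ
    (ι := PUnit) (X := fun _ => X) fun J _ => hX J
  exact ⟨I, D, hD, h ⟨⟩⟩

theorem ProductivelyCompact.intervalCompact {lam μ : Cardinal.{u}}
    (hlam : ℵ₀ ≤ lam) (hμ : ℵ₀ ≤ μ) {X : Type u} [TopologicalSpace X]
    (hX : ProductivelyCompact lam μ X) : IntervalCompact lam μ X := by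
  obtain ⟨I, D, hD, h⟩ := hX.exists_ultrafilterCompact hlam hμ
  exact h.intervalCompact hD

end UltrafilterCompactness

/-! ### Groups and ordinal spaces that detect regularity -/

section Examples

open Order Set Filter Topology

variable {I : Type u} {D : Ultrafilter I}

/-! ### Groups of functions with small support -/

/-- The functions to a two-element group whose support has cardinality less than `κ`. -/
def smallSupportSubgroup (κ : Cardinal.{u}) (hκ : ℵ₀ ≤ κ) (A : Type u) : Subgroup (A → ℤˣ) where
  carrier := {x | #{a | x a ≠ 1} < κ}
  one_mem' := by simpa using aleph0_pos.trans_le hκ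
  mul_mem' {x y} hx hy := by
    refine (mk_le_mk_of_subset ?_).trans_lt ((mk_union_le {a | x a ≠ 1} {a | y a ≠ 1}).trans_lt
      (add_lt_of_lt hκ hx hy))
    intro a ha
    by_contra h
    simp only [mem_union, mem_ofPred_eq, not_or, not_not] at h
    exact ha (by simp [h.1, h.2])
  inv_mem' {x} hx := by simpa using hx

theorem hasClopenBase_of_isInducing {X Y : Type u} [TopologicalSpace X] [TopologicalSpace Y]
    {e : X → Y} (he : IsInducing e) (hY : HasClopenBase Y) : HasClopenBase X := by
  refine isTopologicalBasis_of_isOpen_of_nhds (fun s hs => hs.isOpen) fun x U hx hU => ?_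
  obtain ⟨V, hV, rfl⟩ := he.isOpen_iff.1 hU
  obtain ⟨W, hW, hxW, hWV⟩ := hY.exists_subset_of_mem_open hx hV
  exact ⟨e ⁻¹' W, IsClopen.preimage hW he.continuous, hxW, preimage_mono hWV⟩

theorem hasClopenBase_smallSupportSubgroup {κ : Cardinal.{u}} (hκ : ℵ₀ ≤ κ) (A : Type u) :
    HasClopenBase (smallSupportSubgroup κ hκ A) :=
  hasClopenBase_of_isInducing IsInducing.subtypeVal
    (loc_compact_Haus_tot_disc_of_zero_dim : HasClopenBase (A → ℤˣ))

/-- A limit exists in the compact full power. Each point of its support lies in the support of `x i`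
for most `i`, so a support of size κ or more would make `D` (κ,κ)-regular. -/
theorem ultrafilterCompact_smallSupportSubgroup {κ : Cardinal.{u}} (hκ : ℵ₀ ≤ κ) (A : Type u)
    (hD : ¬ RegularUltrafilter κ κ D) :
    UltrafilterCompact D (smallSupportSubgroup κ hκ A) := by
  intro x
  obtain ⟨y, -, hy⟩ := isCompact_univ.ultrafilter_le_nhds (D.map fun i => (x i).1)
    (by simp)
  have hy' : Tendsto (fun i => (x i).1) D (𝓝 y) := hy
  have hmem : #{a | y a ≠ 1} < κ := by
    by_contra! hcon
    refine hD (.of_eventually (aleph0_pos.trans_le hκ) hcon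
      (fun i => {a | (x i).1 a.1 ≠ 1}) (.of_forall fun i => ?_) ?_)
    · refine lt_of_le_of_lt ?_ (x i).2
      exact mk_preimage_of_injective Subtype.val {a | (x i).1 a ≠ 1} Subtype.val_injective
    · rintro ⟨a, ha⟩
      exact (tendsto_pi_nhds.1 hy' a).eventually ((isOpen_discrete {1}ᶜ).mem_nhds ha)
  exact ⟨⟨y, hmem⟩, tendsto_subtype_rng.2 hy'⟩

/-- No element has full support, so the sets `x a = 1` cover; fewer than κ of them miss the function
equal to -1 exactly on their indices. -/
theorem not_intervalCompact_smallSupportSubgroup {κ : Cardinal.{u}} (hκ : ℵ₀ ≤ κ) {A : Type u}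
    (hA : #A = κ) : ¬ IntervalCompact κ κ (smallSupportSubgroup κ hκ A) := by
  classical
  intro h
  let V : A → Set (smallSupportSubgroup κ hκ A) := fun a => {x | x.1 a = 1}
  obtain ⟨𝒱, h𝒱, hcard, hcov⟩ := h (range V)
    (by
      rintro _ ⟨a, rfl⟩
      have hc : Continuous fun x : smallSupportSubgroup κ hκ A => x.1 a :=
        (continuous_apply a).comp continuous_subtype_val
      exact (isOpen_discrete {1}).preimage hc)
    (by
      refine eq_univ_of_forall fun x => ?_
      by_contra hx
      have hx' : ∀ a, x.1 a ≠ 1 := fun a ha => hx ⟨V a, ⟨a, rfl⟩, ha⟩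
      have h2 : #{a | x.1 a ≠ 1} < κ := x.2
      rw [eq_univ_of_forall (s := {a | x.1 a ≠ 1}) hx', mk_univ, hA] at h2
      exact h2.false)
    (mk_range_le.trans_eq hA)
  choose F hF using h𝒱
  let S : Set A := range fun U : 𝒱 => F U.2
  let x : A → ℤˣ := fun a => if a ∈ S then -1 else 1
  have hx : #{a | x a ≠ 1} < κ := by
    refine (mk_le_mk_of_subset (t := S) fun a ha => ?_).trans_lt (mk_range_le.trans_lt hcard)
    by_contra haS
    exact ha (by simp [x, haS])
  obtain ⟨U, hU, hxU⟩ := (hcov ▸ mem_univ _ : (⟨x, hx⟩ : smallSupportSubgroup κ hκ A) ∈ ⋃₀ 𝒱)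
  rw [← hF hU] at hxU
  have hS : F hU ∈ S := ⟨⟨U, hU⟩, rfl⟩
  have h1 : x (F hU) = 1 := hxU
  simp only [x, if_pos hS] at h1
  exact absurd h1 (by decide)

/-! ### Ordinal spaces -/

section WellOrders

variable {X : Type u} [LinearOrder X] [WellFoundedLT X] [TopologicalSpace X] [OrderTopology X]

theorem isOpen_Iic_of_wellFoundedLT (x : X) : IsOpen (Iic x) := by
  let := SuccOrder.ofLinearWellFoundedLT X
  by_cases hx : IsMax x
  · convert isOpen_univ
    exact eq_univ_of_forall fun y => hx.isTop y
  · rw [← Order.Iio_succ_of_not_isMax hx]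
    exact isOpen_Iio

theorem hasClopenBase_of_wellFoundedLT : HasClopenBase X := by
  have hIic (x : X) : IsClopen (Iic x) := ⟨isClosed_Iic, isOpen_Iic_of_wellFoundedLT x⟩
  refine isTopologicalBasis_of_isOpen_of_nhds (fun s hs => hs.isOpen) fun x U hx hU => ?_
  by_cases hmin : ∃ l, l < x
  · obtain ⟨l, hl, hlU⟩ := exists_Ioc_subset_of_mem_nhds (hU.mem_nhds hx) hmin
    refine ⟨Ioc l x, ?_, ⟨hl, le_rfl⟩, hlU⟩
    rw [← Ioi_inter_Iic, ← compl_Iic]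
    exact (hIic l).compl.inter (hIic x)
  · push Not at hmin
    refine ⟨Iic x, hIic x, le_rfl, fun y hy => ?_⟩
    rwa [le_antisymm hy (hmin y)]

end WellOrders

/-- The order topology on the initial ordinal of a cardinal. -/
noncomputable local instance (ρ : Cardinal.{u}) : TopologicalSpace ρ.ord.ToType := Preorder.topology _

local instance (ρ : Cardinal.{u}) : OrderTopology ρ.ord.ToType := ⟨rfl⟩

/-- A function unbounded modulo `D` has no limit, while one bounded modulo `D` lives in a compact
interval. -/
theorem ultrafilterCompact_ord_toType_iff {ρ : Cardinal.{u}} (hρ : ρ.IsRegular) :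
    UltrafilterCompact D ρ.ord.ToType ↔ ¬ RegularUltrafilter ρ ρ D := by
  have := noMaxOrder hρ.aleph0_le
  have : Nonempty ρ.ord.ToType := Ordinal.nonempty_toType_iff.2 hρ.ord_pos.ne'
  constructor
  · intro h hreg
    obtain ⟨F, hF⟩ := (regularUltrafilter_self_iff hρ).1 hreg
    obtain ⟨y, hy⟩ := h F
    obtain ⟨z, hz⟩ := exists_gt y
    obtain ⟨i, hi, hi'⟩ := ((hy.eventually (Iio_mem_nhds hz)).and (hF z)).exists
    exact lt_asymm hi hi'
  · intro h x
    let := WellFoundedLT.toOrderBot ρ.ord.ToType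
    let := WellFoundedLT.conditionallyCompleteLinearOrderBot ρ.ord.ToType
    obtain ⟨b, hb⟩ := eventually_le_of_not_regularUltrafilter hρ h x
    have hc : IsCompact (Icc ⊥ b) := isCompact_Icc
    obtain ⟨y, -, hy⟩ := hc.ultrafilter_le_nhds (D.map x) (by
      rw [le_principal_iff]
      exact hb.mono fun i hi => ⟨bot_le, hi⟩)
    exact ⟨y, hy⟩

theorem not_intervalCompact_ord_toType {ρ : Cardinal.{u}} (hρ : ρ.IsRegular) :
    ¬ IntervalCompact ρ ρ ρ.ord.ToType := by
  have := noMaxOrder hρ.aleph0_le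
  intro h
  obtain ⟨𝒱, h𝒱, hcard, hcov⟩ := h (range fun a : ρ.ord.ToType => Iio a)
    (by
      rintro _ ⟨a, rfl⟩
      exact isOpen_Iio)
    (eq_univ_of_forall fun x => by
      obtain ⟨y, hy⟩ := exists_gt x
      exact ⟨Iio y, ⟨y, rfl⟩, hy⟩)
    (mk_range_le.trans_eq (mk_ord_toType ρ))
  choose F hF using h𝒱
  have hcof : IsCofinal (range fun U : 𝒱 => F U.2) := by
    intro x
    obtain ⟨U, hU, hxU⟩ := (hcov ▸ mem_univ x : x ∈ ⋃₀ 𝒱)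
    rw [← hF hU] at hxU
    exact ⟨_, ⟨⟨U, hU⟩, rfl⟩, (mem_Iio.1 hxU).le⟩
  refine (Order.cof_le hcof).not_gt (mk_range_le.trans_lt ?_)
  rwa [Ordinal.cof_toType, hρ.cof_ord]

theorem hasClopenBase_sum {X Y : Type u} [TopologicalSpace X] [TopologicalSpace Y]
    (hX : HasClopenBase X) (hY : HasClopenBase Y) : HasClopenBase (X ⊕ Y) := by
  refine isTopologicalBasis_of_isOpen_of_nhds (fun s hs => hs.isOpen) ?_
  rintro (x | y) U hx hU
  · obtain ⟨W, hW, hxW, hWU⟩ := hX.exists_subset_of_mem_open hx (isOpen_sum_iff.1 hU).1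
    exact ⟨Sum.inl '' W, ⟨IsClosedEmbedding.inl.isClosedMap _ hW.isClosed,
      IsOpenEmbedding.inl.isOpenMap _ hW.isOpen⟩, ⟨x, hxW, rfl⟩, image_subset_iff.2 hWU⟩
  · obtain ⟨W, hW, hxW, hWU⟩ := hY.exists_subset_of_mem_open hx (isOpen_sum_iff.1 hU).2
    exact ⟨Sum.inr '' W, ⟨IsClosedEmbedding.inr.isClosedMap _ hW.isClosed,
      IsOpenEmbedding.inr.isOpenMap _ hW.isOpen⟩, ⟨y, hxW, rfl⟩, image_subset_iff.2 hWU⟩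

theorem normalSpace_sum {X Y : Type u} [TopologicalSpace X] [TopologicalSpace Y]
    [NormalSpace X] [NormalSpace Y] : NormalSpace (X ⊕ Y) := by
  refine ⟨fun s t hs ht hst => ?_⟩
  obtain ⟨U₁, V₁, hU₁, hV₁, hsU₁, htV₁, h₁⟩ := normal_separation
    (isClosed_sum_iff.1 hs).1 (isClosed_sum_iff.1 ht).1 (hst.preimage Sum.inl)
  obtain ⟨U₂, V₂, hU₂, hV₂, hsU₂, htV₂, h₂⟩ := normal_separation
    (isClosed_sum_iff.1 hs).2 (isClosed_sum_iff.1 ht).2 (hst.preimage Sum.inr)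
  refine ⟨Sum.inl '' U₁ ∪ Sum.inr '' U₂, Sum.inl '' V₁ ∪ Sum.inr '' V₂,
    (IsOpenEmbedding.inl.isOpenMap _ hU₁).union (IsOpenEmbedding.inr.isOpenMap _ hU₂),
    (IsOpenEmbedding.inl.isOpenMap _ hV₁).union (IsOpenEmbedding.inr.isOpenMap _ hV₂), ?_, ?_, ?_⟩
  · rintro (x | x) hx
    · exact .inl ⟨x, hsU₁ hx, rfl⟩
    · exact .inr ⟨x, hsU₂ hx, rfl⟩
  · rintro (x | x) hx
    · exact .inl ⟨x, htV₁ hx, rfl⟩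
    · exact .inr ⟨x, htV₂ hx, rfl⟩
  · rw [disjoint_left] at h₁ h₂ ⊢
    rintro (x | x) <;> simpa using fun h => by first | exact h₁ h | exact h₂ h

variable {lam μ κ : Cardinal.{u}}

/-- If productive compactness transfers from `[lam, μ]` to `[κ, κ]` for all zero-dimensional normal
spaces, then so does regularity of ultrafilters. -/
theorem regularUltrafilter_of_forall_normalSpace (hκ : ℵ₀ ≤ κ)
    (h : ∀ (X : Type u) [TopologicalSpace X] [T2Space X] [NormalSpace X], HasClopenBase X →
      ProductivelyCompact lam μ X → ProductivelyCompact κ κ X)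
    (hD : RegularUltrafilter lam μ D) : RegularUltrafilter κ κ D := by
  by_contra hcon
  rcases isRegular_or_isSingular hκ with hreg | hsing
  · have hX := (ultrafilterCompact_ord_toType_iff hreg).2 hcon
    obtain ⟨I', D', hD', hX'⟩ := (h _ hasClopenBase_of_wellFoundedLT
      (hX.productivelyCompact hD)).exists_ultrafilterCompact hκ hκ
    exact (ultrafilterCompact_ord_toType_iff hreg).1 hX' hD'
  · have hθ : κ.ord.cof.IsRegular := isRegular_cof (isSuccLimit_ord hκ)
    have hs : (succ κ).IsRegular := isRegular_succ hκ
    rw [regularUltrafilter_iff_of_isSingular hsing, not_or] at hcon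
    have hX := ((ultrafilterCompact_ord_toType_iff hθ).2 hcon.1).sum
      ((ultrafilterCompact_ord_toType_iff hs).2 hcon.2)
    have := normalSpace_sum (X := κ.ord.cof.ord.ToType) (Y := (succ κ).ord.ToType)
    obtain ⟨I', D', hD', hX'⟩ := (h _ (hasClopenBase_sum hasClopenBase_of_wellFoundedLT
      hasClopenBase_of_wellFoundedLT)
      (hX.productivelyCompact hD)).exists_ultrafilterCompact hκ hκ
    -- Both summands are closed, hence `D'`-compact, so `D'` is regular at neither cf κ nor κ⁺.
    rcases (regularUltrafilter_iff_of_isSingular hsing).1 hD' with h' | h'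
    · exact (ultrafilterCompact_ord_toType_iff hθ).1
        (.of_isClosedEmbedding IsClosedEmbedding.inl hX') h'
    · exact (ultrafilterCompact_ord_toType_iff hs).1
        (.of_isClosedEmbedding IsClosedEmbedding.inr hX') h'

theorem regularUltrafilter_of_forall_group (hκ : ℵ₀ ≤ κ)
    (h : ∀ (G : Type u) [Group G] [TopologicalSpace G] [IsTopologicalGroup G] [T35Space G],
      HasClopenBase G → ProductivelyCompact lam μ G → IntervalCompact κ κ G)
    (hD : RegularUltrafilter lam μ D) : RegularUltrafilter κ κ D := by
  by_contra hcon
  exact not_intervalCompact_smallSupportSubgroup hκ (mk_out κ)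
    (h _ (hasClopenBase_smallSupportSubgroup hκ _)
      ((ultrafilterCompact_smallSupportSubgroup hκ _ hcon).productivelyCompact hD))

theorem regularUltrafilter_of_forall_normalSpace_of_isRegular (hκ : κ.IsRegular)
    (h : ∀ (X : Type u) [TopologicalSpace X] [T2Space X] [NormalSpace X], HasClopenBase X →
      ProductivelyCompact lam μ X → IntervalCompact κ κ X)
    (hD : RegularUltrafilter lam μ D) : RegularUltrafilter κ κ D := by
  by_contra hcon
  exact not_intervalCompact_ord_toType hκ (h _ hasClopenBase_of_wellFoundedLT
    (((ultrafilterCompact_ord_toType_iff hκ).2 hcon).productivelyCompact hD))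

theorem FamilyProductivelyCompact.of_forall_regularUltrafilter (hlam : ℵ₀ ≤ lam) (hμ : ℵ₀ ≤ μ)
    (h : ∀ (I : Type u) (D : Ultrafilter I), RegularUltrafilter lam μ D → RegularUltrafilter κ κ D)
    {ι : Type u} {X : ι → Type u} [∀ i, TopologicalSpace (X i)]
    (hX : FamilyProductivelyCompact lam μ X) : FamilyProductivelyCompact κ κ X := by
  obtain ⟨I, D, hD, hDX⟩ := hX.exists_ultrafilterCompact hlam hμ
  exact UltrafilterCompact.familyProductivelyCompact (h I D hD) hDX

end Examples

/-! ### The equivalences -/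

theorem theorem3 (lam μ κ : Cardinal.{u}) (hlam : ℵ₀ ≤ lam) (hμ : ℵ₀ ≤ μ) (hκ : ℵ₀ ≤ κ) :
    List.TFAE [
      -- (i), second "productively" omitted
      ∀ (X : Type u) [TopologicalSpace X],
        ProductivelyCompact lam μ X → IntervalCompact κ κ X,
      -- (i), second "productively" inserted
      ∀ (X : Type u) [TopologicalSpace X],
        ProductivelyCompact lam μ X → ProductivelyCompact κ κ X,
      -- (ii)
      ∀ (ι : Type u) (X : ι → Type u) [∀ i, TopologicalSpace (X i)],
        FamilyProductivelyCompact lam μ X → FamilyProductivelyCompact κ κ X,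
      -- (iii)
      ∀ (I : Type u) (D : Ultrafilter I),
        RegularUltrafilter lam μ D → RegularUltrafilter κ κ D,
      -- (iv)
      ∀ (X : Type u) [TopologicalSpace X] [T2Space X] [NormalSpace X], HasClopenBase X →
        ProductivelyCompact lam μ X → ProductivelyCompact κ κ X,
      -- (v), second "productively" omitted
      ∀ (G : Type u) [Group G] [TopologicalSpace G] [IsTopologicalGroup G] [T35Space G],
        HasClopenBase G → ProductivelyCompact lam μ G → IntervalCompact κ κ G,
      -- (v), second "productively" inserted
      ∀ (G : Type u) [Group G] [TopologicalSpace G] [IsTopologicalGroup G] [T35Space G],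
        HasClopenBase G → ProductivelyCompact lam μ G → ProductivelyCompact κ κ G] ∧
    -- for regular cardinals, all of the above is moreover equivalent to (vi)
    (κ.IsRegular →
      ((∀ (I : Type u) (D : Ultrafilter I),
          RegularUltrafilter lam μ D → RegularUltrafilter κ κ D) ↔
        ∀ (X : Type u) [TopologicalSpace X] [T2Space X] [NormalSpace X], HasClopenBase X →
          ProductivelyCompact lam μ X → IntervalCompact κ κ X)) := by
  have h23 : (∀ (ι : Type u) (X : ι → Type u) [∀ i, TopologicalSpace (X i)],
      FamilyProductivelyCompact lam μ X → FamilyProductivelyCompact κ κ X) →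
      ∀ (X : Type u) [TopologicalSpace X],
        ProductivelyCompact lam μ X → ProductivelyCompact κ κ X :=
    fun h X _ hX J => h PUnit (fun _ => X) (fun J _ => hX J) J fun _ => ⟨⟩
  refine ⟨?_, fun hreg => ⟨fun h X _ _ _ _ hX => ?_, fun h I D hD =>
    regularUltrafilter_of_forall_normalSpace_of_isRegular hreg h hD⟩⟩
  · tfae_have 4 → 3 := fun h ι X _ hX => hX.of_forall_regularUltrafilter hlam hμ h
    tfae_have 3 → 2 := h23
    tfae_have 2 → 1 := fun h X _ hX => (h X hX).intervalCompact hκ hκ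
    tfae_have 2 → 5 := fun h X _ _ _ _ hX => h X hX
    tfae_have 2 → 7 := fun h G _ _ _ _ _ hG => h G hG
    tfae_have 7 → 6 := fun h G _ _ _ _ hb hG => (h G hb hG).intervalCompact hκ hκ
    tfae_have 1 → 6 := fun h G _ _ _ _ _ hG => h G hG
    tfae_have 5 → 4 := fun h I D hD => regularUltrafilter_of_forall_normalSpace hκ h hD
    tfae_have 6 → 4 := fun h I D hD => regularUltrafilter_of_forall_group hκ h hD
    tfae_finish
  · exact (h23 (fun ι X _ hX => hX.of_forall_regularUltrafilter hlam hμ h) X hX).intervalCompact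
      hκ hκ
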